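/- Let $\mathbb S^2\subset\mathbb R^3$ be the unit sphere with its round metric, with area measure $dV$. Let $$\mathring{\mathcal M}_1=\Big\{u\in H^1(\mathbb S^2)\;:\;\int_{\mathbb S^2}x_i e^{2u}\,dV=0,\ i=1,2,3\Big\},$$ and for $u\in H^1(\mathbb S^2)$ let $\Lambda(u)=(\Lambda_{ij}(u))_{1\le i,j\le3}$ with $$\Lambda_{ij}(u)=\frac{\int_{\mathbb S^2}e^{2u}\big(x_ix_j-\tfrac13\delta_{ij}\big)\,dV}{\int_{\mathbb S^2}e^{2u}\,dV},\qquad \|\Lambda(u)\|^2=\sum_{i,j=1}^3\Lambda_{ij}(u)^2 .$$ Let $\alpha>0$. For $c\in\mathbb R$ consider the inequality $$\log\frac1{4\pi}\int_{\mathbb S^2}e^{2u}\,dV\;\le\;\frac{\alpha}{4\pi}\int_{\mathbb S^2}|\nabla u|^2\,dV+\frac{2}{4\pi}\int_{\mathbb S^2}u\,dV+c.\qquad(\ast)$$ (1) Let $0<\delta<\frac12$. If there is $c\in\mathbb R$ such that $(\ast)$ holds for all $u\in\mathring{\mathcal M}_1$ with $\|\Lambda(u)\|^2\le\frac23-\delta$,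 then $\alpha\ge\frac13$. (2) Let $0<\delta\le\frac16$. If there is $c\in\mathbb R$ such that $(\ast)$ holds for all $u\in\mathring{\mathcal M}_1$ with $\|\Lambda(u)\|^2\le\frac16-\delta$, then $\alpha\ge\frac14$. -/

import Mathlib

open MeasureTheory

open scoped ContDiff

noncomputable section

namespace SphereMTO

/-- Euclidean three-space. -/
abbrev E3 : Type := EuclideanSpace ℝ (Fin 3)

/-- The unit sphere `𝕊²` of `ℝ³`. -/
abbrev S2 : Type := Metric.sphere (0 : E3) 1

/-- The area measure of the round metric on `𝕊²` (total mass `4π`). -/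
def area : Measure S2 := (volume : Measure E3).toSphere

instance : IsFiniteMeasure area := by unfold area; infer_instance

/-- An ambient vector field is tangent along `𝕊²` if `X(x) ⊥ x` at every point `x` of `𝕊²`. Every
smooth tangent vector field of `𝕊²` is the restriction of a smooth field of this kind. -/
def IsTangentAlongSphere (X : E3 → E3) : Prop :=
  ∀ x : S2, inner ℝ (X x) (x : E3) = 0

/-- The divergence on `𝕊²` of (the restriction of) a tangent field `X`: the trace of `DX(x)` over
the tangent plane `x^⊥`, that is, its full trace minus its normal part. It depends on the values of
`X` on `𝕊²` only. -/
def sphereDiv (X : E3 → E3) (x : S2) : ℝ :=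
  (∑ i : Fin 3, fderiv ℝ X x (EuclideanSpace.single i 1) i) - inner ℝ (fderiv ℝ X x x) (x : E3)

/-- `G` is a weak gradient of `u` on `𝕊²`: a square integrable, almost everywhere tangent vector
field with `∫ ⟨G, X⟩ = - ∫ u div X` for every smooth tangent vector field `X`. -/
structure IsWeakGradient (u : S2 → ℝ) (G : S2 → E3) : Prop where
  memLp : MemLp G 2 area
  tangent : ∀ᵐ x ∂area, inner ℝ (G x) (x : E3) = 0
  integral_inner : ∀ X : E3 → E3, ContDiff ℝ ∞ X → IsTangentAlongSphere X →
    ∫ x, inner ℝ (G x) (X x) ∂area = - ∫ x, u x * sphereDiv X x ∂area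

/-- Membership in the Sobolev space `H¹(𝕊²)`. -/
def MemH1 (u : S2 → ℝ) : Prop :=
  MemLp u 2 area ∧ ∃ G : S2 → E3, IsWeakGradient u G

open Classical in
/-- The weak gradient `∇u` of `u` (zero if there is none). -/
def weakGrad (u : S2 → ℝ) : S2 → E3 :=
  if h : ∃ G : S2 → E3, IsWeakGradient u G then h.choose else 0

/-- The set `M̊₁` of all `u ∈ H¹(𝕊²)` with `∫ xᵢ e^{2u} = 0` for `i = 1, 2, 3`. (The function
`e^{2u}` is integrable for every `u ∈ H¹(𝕊²)`.) -/
def zeroMoment : Set (S2 → ℝ) :=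
  {u | MemH1 u ∧ ∀ i : Fin 3, ∫ x : S2, (x : E3) i * Real.exp (2 * u x) ∂area = 0}

/-- The matrix `Λ(u)` of the normalized trace-free second moments of `e^{2u}`. -/
def Lam (u : S2 → ℝ) : Matrix (Fin 3) (Fin 3) ℝ := fun i j =>
  (∫ x : S2, Real.exp (2 * u x) *
      ((x : E3) i * (x : E3) j - 1 / 3 * (if i = j then 1 else 0)) ∂area) /
    ∫ x : S2, Real.exp (2 * u x) ∂area

/-- The norm `‖Λ‖ = (∑ᵢⱼ Λᵢⱼ²)^{1/2}` of a matrix. -/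
def frobNorm (A : Matrix (Fin 3) (Fin 3) ℝ) : ℝ :=
  Real.sqrt (∑ i, ∑ j, A i j ^ 2)

/-- The inequality
`log ⨍ e^{2u} ≤ α ⨍ |∇u|² + 2 ⨍ u + c` for the function `u`. -/
def MTOInequality (α c : ℝ) (u : S2 → ℝ) : Prop :=
  Real.log (⨍ x, Real.exp (2 * u x) ∂area) ≤
    α * (⨍ x, ‖weakGrad u x‖ ^ 2 ∂area) + 2 * (⨍ x, u x ∂area) + c

theorem weakGrad_spec {u : S2 → ℝ} (h : MemH1 u) : IsWeakGradient u (weakGrad u) := by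
  unfold weakGrad
  rw [dif_pos h.2]
  exact h.2.choose_spec

/-- The weak gradient is unique up to null sets, so that `weakGrad` does not depend on a choice. -/
theorem IsWeakGradient.ae_eq {u : S2 → ℝ} {G H : S2 → E3}
    (hG : IsWeakGradient u G) (hH : IsWeakGradient u H) : G =ᵐ[area] H := by
  have key : ∀ i : Fin 3, ∀ᵐ x ∂area, G x i - H x i = 0 := by
    intro i
    have hemb : MeasurableEmbedding (Subtype.val : S2 → E3) :=
      MeasurableEmbedding.subtype_coe (Metric.isClosed_sphere.measurableSet)
    have hcoord : ∀ {F : S2 → E3}, MemLp F 2 area → Integrable (fun x => F x i) area := by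
      intro F hF
      exact (EuclideanSpace.proj (𝕜 := ℝ) i).integrable_comp (hF.integrable (by norm_num))
    let D : S2 → ℝ := fun x => G x i - H x i
    have hD : Integrable D area := (hcoord hG.memLp).sub (hcoord hH.memLp)
    let D' : E3 → ℝ := Function.extend Subtype.val D 0
    have hD' : D' ∘ Subtype.val = D := Function.extend_comp Subtype.val_injective D 0
    have hint : Integrable D' (Measure.map Subtype.val area) := by
      rw [hemb.integrable_map_iff, hD']; exact hD
    have hzero : ∀ᵐ y ∂(Measure.map Subtype.val area), D' y = 0 := by
      refine ae_eq_zero_of_integral_contDiff_smul_eq_zero hint.locallyIntegrable ?_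
      intro g hg _
      rw [hemb.integral_map]
      let X : E3 → E3 := fun y => g y • (inner ℝ y y • EuclideanSpace.single i 1 - y i • y)
      have hXs : ContDiff ℝ ∞ X := by
        refine hg.smul (((contDiff_id.inner ℝ contDiff_id).smul contDiff_const).sub
          (ContDiff.smul (f := fun y : E3 => y i) (g := fun y : E3 => y) ?_ contDiff_id))
        exact (EuclideanSpace.proj (𝕜 := ℝ) i : E3 →L[ℝ] ℝ).contDiff
      have hn : ∀ x : S2, inner ℝ (x : E3) (x : E3) = 1 := by
        intro x
        rw [real_inner_self_eq_norm_sq, norm_eq_of_mem_sphere x]; norm_num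
      have hXt : IsTangentAlongSphere X := by
        intro x
        have := hn x
        simp only [X, inner_smul_left, inner_sub_left, this, EuclideanSpace.inner_single_left]
        simp
      have e : ∀ {F : S2 → E3}, IsWeakGradient u F →
          (fun x => inner ℝ (F x) (X x)) =ᵐ[area] fun x : S2 => g x * F x i := by
        intro F hF
        filter_upwards [hF.tangent] with x hx
        simp only [X, inner_smul_right, inner_sub_right, hn, hx, EuclideanSpace.inner_single_right]
        simp
      have hI := (hG.integral_inner X hXs hXt).trans (hH.integral_inner X hXs hXt).symm
      rw [integral_congr_ae (e hG), integral_congr_ae (e hH)] at hI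
      obtain ⟨C, hC⟩ : ∃ C, ∀ x : S2, ‖g x‖ ≤ C := by
        obtain ⟨C, hC⟩ := (isCompact_univ (X := S2)).exists_bound_of_continuousOn
          (hg.continuous.comp continuous_subtype_val).continuousOn
        exact ⟨C, fun x => hC x trivial⟩
      have hgi : ∀ {F : S2 → E3}, MemLp F 2 area → Integrable (fun x : S2 => g x * F x i) area :=
        fun hF => (hcoord hF).bdd_mul
          (hg.continuous.comp continuous_subtype_val).aestronglyMeasurable
          (Filter.Eventually.of_forall hC)
      have : ∀ x : S2, g x • D' x = g x * G x i - g x * H x i := by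
        intro x
        have : D' x = D x := congrFun hD' x
        rw [this, smul_eq_mul, mul_sub]
      simp_rw [this]
      rw [integral_sub (hgi hG.memLp) (hgi hH.memLp), hI, sub_self]
    rw [hemb.ae_map_iff] at hzero
    filter_upwards [hzero] with x hx
    have : D' x = D x := congrFun hD' x
    rwa [this] at hx
  filter_upwards [ae_all_iff.2 key] with x hx
  ext i
  exact sub_eq_zero.1 (hx i)

end SphereMTO

end

noncomputable section

open Set Filter Topology

open scoped Pointwise

/-! The inequality is tested on sums of `k` logarithmic bubbles `u = -∑ log (ε + |x - pᵢ|²)` as `ε →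
0`. The average of `e^{2u}` is at least a constant times `1/ε`, the mean of `u` is bounded above,
and the average of `|∇u|²` is at most `k (-log ε) + C`, since bubbles at distinct points interact
only boundedly. Hence `-log ε ≤ α k (-log ε) + O(1)`, which forces `α ≥ 1/k` (`one_div_card_le`).

It remains to place the points so that the constraints hold; `e^{2u}` inherits every symmetry of the
configuration. For a regular tetrahedron the first moments and `Λ` vanish exactly, which gives
`1/4`. For an equilateral triangle on a great circle the first moments vanish and `‖Λ‖² ≤ 1/6 < 2/3
- δ` once `ε` is small, which gives `1/3`.

The averages are computed with Archimedes' theorem (`integral_comp_inner`): the squared distance to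
a point is uniformly distributed on `[0, 4]`. The weak gradient is identified through the divergence
theorem (`integral_sphereDiv`). Both rest on the rotation invariance of the area measure. -/

namespace SphereMTO


/-! ### Isometry invariance of the area measure -/

/-- The self-map of the sphere induced by a linear isometry. -/
def sphereMap (L : E3 ≃ₗᵢ[ℝ] E3) (x : S2) : S2 := ⟨L x, by simp⟩

theorem continuous_sphereMap (L : E3 ≃ₗᵢ[ℝ] E3) : Continuous (sphereMap L) :=
  (L.continuous.comp continuous_subtype_val).subtype_mk _

/-- Linear isometries preserve the area measure. -/
theorem measurePreserving_sphereMap (L : E3 ≃ₗᵢ[ℝ] E3) :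
    MeasurePreserving (sphereMap L) area area := by
  refine ⟨(continuous_sphereMap L).measurable, ?_⟩
  ext s hs
  rw [Measure.map_apply (continuous_sphereMap L).measurable hs]
  unfold area
  rw [Measure.toSphere_apply' _ hs,
    Measure.toSphere_apply' _ ((continuous_sphereMap L).measurable hs)]
  congr 1
  -- The area of `s` is a multiple of the volume of the cone `(0, 1) • s`, so invariance reduces to
  -- that of Lebesgue measure.
  rw [← L.measurePreserving.measure_preimage_equiv (f := L.toMeasurableEquiv)
    (Ioo (0 : ℝ) 1 • (Subtype.val '' s : Set E3))]
  congr 1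
  ext y
  constructor
  · rintro ⟨r, hr, _, ⟨z, hz, rfl⟩, h⟩
    exact ⟨r, hr, L z, ⟨sphereMap L z, hz, rfl⟩,
      (L.map_smul r (z : E3)).symm.trans (congrArg L h)⟩
  · rintro ⟨r, hr, _, ⟨z, hz, rfl⟩, h⟩
    refine ⟨r, hr, L.symm z, ⟨sphereMap L.symm z, ?_, rfl⟩, ?_⟩
    · have : sphereMap L (sphereMap L.symm z) = z := Subtype.ext (L.apply_symm_apply _)
      rwa [mem_preimage, this]
    · apply L.injective
      refine (L.map_smul r _).trans ?_
      rw [L.apply_symm_apply]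
      exact h

theorem integral_comp_isometry (L : E3 ≃ₗᵢ[ℝ] E3) {f : E3 → ℝ} (hf : Continuous f) :
    ∫ x : S2, f (L x) ∂area = ∫ x : S2, f x ∂area := by
  have h := integral_map (μ := area) (continuous_sphereMap L).measurable.aemeasurable
    (f := fun x : S2 => f x) (hf.comp continuous_subtype_val).aestronglyMeasurable
  rw [(measurePreserving_sphereMap L).map_eq] at h
  exact h.symm

theorem exists_bound_sphere {f : E3 → ℝ} (hf : Continuous f) : ∃ C, ∀ x : S2, ‖f x‖ ≤ C := by
  obtain ⟨C, hC⟩ := (isCompact_univ (X := S2)).exists_bound_of_continuousOn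
    (hf.comp continuous_subtype_val).continuousOn
  exact ⟨C, fun x => hC x trivial⟩

theorem memLp_sphere {F : Type*} [NormedAddCommGroup F] {f : S2 → F}
    (hf : Continuous f) (p : ENNReal) : MemLp f p area := by
  obtain ⟨C, hC⟩ := (isCompact_univ (X := S2)).exists_bound_of_continuousOn hf.continuousOn
  exact MemLp.of_bound hf.aestronglyMeasurable_of_compactSpace C (ae_of_all _ fun x => hC x trivial)

theorem integrable_sphere {f : S2 → ℝ} (hf : Continuous f) : Integrable f area :=
  memLp_one_iff_integrable.1 (memLp_sphere hf 1)

/-- The derivative of a smooth function along an infinitesimal rotation has integral zero. -/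
theorem integral_fderiv_skew {f : E3 → ℝ} (hf : ContDiff ℝ 1 f) (A : E3 →L[ℝ] E3)
    (hA : ∀ x y, inner ℝ (A x) y = - inner ℝ x (A y)) :
    ∫ x : S2, fderiv ℝ f x (A x) ∂area = 0 := by
  -- A skew operator exponentiates to isometries `L t`. The integral of `f ∘ L t` is constant in
  -- `t`, so its derivative at `0`, taken under the integral, vanishes.
  have hsk : A ∈ skewAdjoint (E3 →L[ℝ] E3) := by
    rw [skewAdjoint.mem_iff, ContinuousLinearMap.star_eq_adjoint]
    ext1 x
    refine ext_inner_right ℝ fun y => ?_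
    rw [ContinuousLinearMap.adjoint_inner_left, neg_apply, inner_neg_left, hA,
      neg_neg]
  let _ : NormedAlgebra ℚ (E3 →L[ℝ] E3) := .restrictScalars ℚ ℝ _
  have hu : ∀ t : ℝ, NormedSpace.exp (t • A) ∈ unitary (E3 →L[ℝ] E3) := fun t =>
    NormedSpace.exp_mem_unitary_of_mem_skewAdjoint (skewAdjoint.smul_mem t hsk)
  let L : ℝ → E3 ≃ₗᵢ[ℝ] E3 := fun t => Unitary.linearIsometryEquiv ⟨_, hu t⟩
  have hL : ∀ t x, L t x = NormedSpace.exp (t • A) x := fun t x => rfl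
  have hder : ∀ t (x : E3), HasDerivAt (fun s => f (L s x)) (fderiv ℝ f (L t x) (A (L t x))) t := by
    intro t x
    have h1 : HasDerivAt (fun s : ℝ => L s x) (A (L t x)) t := by
      have := (hasDerivAt_exp_smul_const' A t).clm_apply (hasDerivAt_const t x)
      simpa [hL] using this
    exact ((hf.differentiable one_ne_zero _).hasFDerivAt).comp_hasDerivAt t h1
  obtain ⟨C, hC⟩ := exists_bound_sphere (f := fun x => ‖fderiv ℝ f x‖)
    (hf.continuous_fderiv one_ne_zero).norm
  have hcont : Continuous fun x => fderiv ℝ f x (A x) :=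
    (hf.continuous_fderiv one_ne_zero).clm_apply A.continuous
  have main := (hasDerivAt_integral_of_dominated_loc_of_deriv_le (μ := area) (x₀ := (0 : ℝ))
    (s := univ) (F := fun t (x : S2) => f (L t x))
    (F' := fun t (x : S2) => fderiv ℝ f (L t x) (A (L t x))) (bound := fun _ => C * ‖A‖)
    univ_mem
    (Eventually.of_forall fun t => ((hf.continuous.comp (L t).continuous).comp
      continuous_subtype_val).aestronglyMeasurable)
    (integrable_sphere ((hf.continuous.comp (L 0).continuous).comp continuous_subtype_val))
    ((hcont.comp (L 0).continuous).comp continuous_subtype_val).aestronglyMeasurable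
    (ae_of_all _ fun x t _ => ?_) (integrable_const _)
    (ae_of_all _ fun x t _ => hder t x)).2
  · have hc : (fun t => ∫ x : S2, f (L t x) ∂area) = fun _ => ∫ x : S2, f x ∂area :=
      funext fun t => integral_comp_isometry (L t) hf.continuous
    rw [hc] at main
    have h0 : ∀ x, L 0 x = x := fun x => by rw [hL, zero_smul ℝ A, NormedSpace.exp_zero]; rfl
    simpa only [h0] using main.unique (hasDerivAt_const _ _)
  · have h1 := hC (sphereMap (L t) x)
    rw [norm_norm] at h1
    calc _ ≤ ‖fderiv ℝ f (L t x)‖ * ‖A (L t x)‖ := ContinuousLinearMap.le_opNorm _ _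
      _ ≤ C * ‖A‖ := by
        gcongr
        · exact (norm_nonneg _).trans h1
        · exact h1
        · refine (A.le_opNorm _).trans ?_
          simp

/-! ### The divergence theorem on the sphere -/

/-- The infinitesimal rotation in the plane of the `i`-th and `j`-th coordinates. -/
def rotGen (i j : Fin 3) : E3 →L[ℝ] E3 :=
  (EuclideanSpace.proj (𝕜 := ℝ) i : E3 →L[ℝ] ℝ).smulRight (EuclideanSpace.single j (1 : ℝ)) -
  (EuclideanSpace.proj (𝕜 := ℝ) j : E3 →L[ℝ] ℝ).smulRight (EuclideanSpace.single i (1 : ℝ))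

theorem rotGen_apply (i j : Fin 3) (x : E3) : rotGen i j x =
    x i • EuclideanSpace.single j (1 : ℝ) - x j • EuclideanSpace.single i (1 : ℝ) := rfl

theorem rotGen_skew (i j : Fin 3) (x y : E3) :
    inner ℝ (rotGen i j x) y = - inner ℝ x (rotGen i j y) := by
  simp [rotGen_apply, inner_sub_left, inner_sub_right, inner_smul_left, inner_smul_right,
    EuclideanSpace.inner_single_left, EuclideanSpace.inner_single_right]
  ring

theorem inner_eq_sum (x y : E3) : inner ℝ x y = x 0 * y 0 + x 1 * y 1 + x 2 * y 2 := by
  simp [PiLp.inner_apply, Fin.sum_univ_three]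
  ring

theorem sum_sq_eq_one (x : S2) :
    (x : E3) 0 ^ 2 + (x : E3) 1 ^ 2 + (x : E3) 2 ^ 2 = 1 := by
  have h : inner ℝ (x : E3) (x : E3) = 1 := by
    rw [real_inner_self_eq_norm_sq, norm_eq_of_mem_sphere x]; norm_num
  rw [inner_eq_sum] at h
  linarith

theorem eq_sum_single (v : E3) : v = v 0 • EuclideanSpace.single (0 : Fin 3) (1 : ℝ) +
    v 1 • EuclideanSpace.single (1 : Fin 3) (1 : ℝ) +
    v 2 • EuclideanSpace.single (2 : Fin 3) (1 : ℝ) := by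
  ext i
  fin_cases i <;> simp

/-- The divergence theorem on the sphere. -/
theorem integral_sphereDiv {X : E3 → E3} (hX : ContDiff ℝ ∞ X) (hT : IsTangentAlongSphere X) :
    ∫ x : S2, sphereDiv X x ∂area = 0 := by
  -- Components of the cross product `x × X`. For tangent `X` the divergence is the sum of their
  -- derivatives along the three coordinate rotations, each of integral zero.
  let f : Fin 3 → Fin 3 → E3 → ℝ := fun i j x => x i * X x j - x j * X x i
  have hco : ∀ i, ContDiff ℝ ∞ fun x : E3 => x i := fun i =>
    (EuclideanSpace.proj (𝕜 := ℝ) i : E3 →L[ℝ] ℝ).contDiff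
  have hXc : ∀ i, ContDiff ℝ ∞ fun x : E3 => X x i := fun i => (hco i).comp hX
  have hf : ∀ i j, ContDiff ℝ 1 (f i j) := fun i j =>
    (((hco i).mul (hXc j)).sub ((hco j).mul (hXc i))).of_le (by simp)
  have hfd : ∀ i j x v, fderiv ℝ (f i j) x v =
      x i * fderiv ℝ X x v j + v i * X x j - (x j * fderiv ℝ X x v i + v j * X x i) := by
    intro i j x v
    have h1 : ∀ i, HasFDerivAt (fun x : E3 => x i)
        (EuclideanSpace.proj (𝕜 := ℝ) i : E3 →L[ℝ] ℝ) x :=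
      fun i => (EuclideanSpace.proj (𝕜 := ℝ) i : E3 →L[ℝ] ℝ).hasFDerivAt
    have h2 : ∀ i, HasFDerivAt (fun x : E3 => X x i)
        ((EuclideanSpace.proj (𝕜 := ℝ) i : E3 →L[ℝ] ℝ).comp (fderiv ℝ X x)) x := fun i =>
      (EuclideanSpace.proj (𝕜 := ℝ) i : E3 →L[ℝ] ℝ).hasFDerivAt.comp x
        (hX.differentiable (by simp) x).hasFDerivAt
    have := (((h1 i).mul (h2 j)).sub ((h1 j).mul (h2 i))).fderiv
    have e : fderiv ℝ (f i j) x = _ := this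
    rw [e]
    simp
    ring
  have key : ∀ x : S2, sphereDiv X x = fderiv ℝ (f 0 1) x (rotGen 0 1 x) +
      fderiv ℝ (f 1 2) x (rotGen 1 2 x) + fderiv ℝ (f 2 0) x (rotGen 2 0 x) := by
    intro x
    have hx := sum_sq_eq_one x
    have ht := hT x
    rw [inner_eq_sum] at ht
    unfold sphereDiv
    simp only [hfd]
    have hlin : fderiv ℝ X x x =
        (x : E3) 0 • fderiv ℝ X x (EuclideanSpace.single (0 : Fin 3) (1 : ℝ))
        + (x : E3) 1 • fderiv ℝ X x (EuclideanSpace.single (1 : Fin 3) (1 : ℝ)) +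
        (x : E3) 2 • fderiv ℝ X x (EuclideanSpace.single (2 : Fin 3) (1 : ℝ)) := by
      conv_lhs => enter [2]; rw [eq_sum_single (x : E3)]
      simp only [map_add, map_smul]
    rw [hlin, inner_eq_sum, Fin.sum_univ_three]
    simp only [rotGen_apply, map_sub, map_smul, PiLp.sub_apply, PiLp.add_apply, PiLp.smul_apply,
      smul_eq_mul, PiLp.single_apply]
    norm_num [Fin.ext_iff]
    generalize fderiv ℝ X x (EuclideanSpace.single (0 : Fin 3) (1 : ℝ)) = a at *
    generalize fderiv ℝ X x (EuclideanSpace.single (1 : Fin 3) (1 : ℝ)) = b at *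
    generalize fderiv ℝ X x (EuclideanSpace.single (2 : Fin 3) (1 : ℝ)) = c at *
    linear_combination (-(a 0 + b 1 + c 2)) * hx + 2 * ht
  have hI : ∀ i j, Integrable (fun x : S2 => fderiv ℝ (f i j) x (rotGen i j x)) area := fun i j =>
    integrable_sphere ((((hf i j).continuous_fderiv one_ne_zero).clm_apply
      (rotGen i j).continuous).comp continuous_subtype_val)
  simp_rw [key]
  rw [integral_add (by exact (hI 0 1).add (hI 1 2)) (hI 2 0), integral_add (hI 0 1) (hI 1 2)]
  simp only [integral_fderiv_skew (hf _ _) _ (rotGen_skew _ _), add_zero]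

/-! ### Weak gradients of restrictions of smooth functions -/

/-- The tangential part of the gradient of an ambient function. -/
def tangGrad (U : E3 → ℝ) (x : S2) : E3 :=
  gradient U x - inner ℝ (gradient U x) (x : E3) • (x : E3)

theorem inner_self_sphere (x : S2) : inner ℝ (x : E3) (x : E3) = 1 := by
  rw [real_inner_self_eq_norm_sq, norm_eq_of_mem_sphere x]; norm_num

/-- In the normal part, the term that differentiates `U` carries the factor `⟨X x, x⟩`, which is
zero by tangency; so the Leibniz rule needs no correction. -/
theorem sphereDiv_smul {U : E3 → ℝ} {X : E3 → E3} (hU : ContDiff ℝ ∞ U) (hX : ContDiff ℝ ∞ X)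
    (hT : IsTangentAlongSphere X) (x : S2) :
    sphereDiv (fun y => U y • X y) x = U x * sphereDiv X x + fderiv ℝ U x (X x) := by
  have h : fderiv ℝ (fun y => U y • X y) x = _ :=
    (((hU.differentiable (by simp) x).hasFDerivAt).smul
    (hX.differentiable (by simp) x).hasFDerivAt).fderiv
  have hlin : fderiv ℝ U x (X x) = X x 0 * fderiv ℝ U x (EuclideanSpace.single (0 : Fin 3) (1 : ℝ))
      + X x 1 * fderiv ℝ U x (EuclideanSpace.single (1 : Fin 3) (1 : ℝ)) +
      X x 2 * fderiv ℝ U x (EuclideanSpace.single (2 : Fin 3) (1 : ℝ)) := by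
    conv_lhs => rw [eq_sum_single (X x)]
    simp only [map_add, map_smul, smul_eq_mul]
  have ht := hT x
  unfold sphereDiv
  rw [h, hlin, Fin.sum_univ_three, Fin.sum_univ_three]
  simp [inner_add_left, inner_smul_left, ht]
  ring

theorem continuous_gradient {U : E3 → ℝ} (hU : ContDiff ℝ ∞ U) : Continuous (gradient U) :=
  (InnerProductSpace.toDual ℝ E3).symm.continuous.comp (hU.continuous_fderiv (by simp))

/-- The weak gradient of the restriction of a smooth function is its tangential gradient. -/
theorem isWeakGradient_tangGrad {U : E3 → ℝ} (hU : ContDiff ℝ ∞ U) :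
    IsWeakGradient (fun x => U x) (tangGrad U) := by
  have hg : Continuous fun x : S2 => gradient U x :=
    (continuous_gradient hU).comp continuous_subtype_val
  refine ⟨memLp_sphere ?_ 2, ae_of_all _ fun x => ?_, fun X hX hT => ?_⟩
  · unfold tangGrad
    fun_prop
  · rw [tangGrad, inner_sub_left, inner_smul_left, inner_self_sphere]
    simp
  · have hUX : IsTangentAlongSphere fun y => U y • X y := fun x => by
      simp [inner_smul_left, hT x]
    have hUXs : ContDiff ℝ ∞ fun y => U y • X y := hU.smul hX
    have h0 := integral_sphereDiv hUXs hUX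
    have hpt : ∀ x : S2, inner ℝ (tangGrad U x) (X x) =
        sphereDiv (fun y => U y • X y) x - U x * sphereDiv X x := by
      intro x
      rw [sphereDiv_smul hU hX hT, tangGrad, inner_sub_left, inner_smul_left,
        real_inner_comm, real_inner_comm (X x) (x : E3), hT x, real_inner_comm]
      simp [gradient]
    have hdc : ∀ {Y : E3 → E3}, ContDiff ℝ ∞ Y → Continuous fun x : S2 => sphereDiv Y x := by
      intro Y hY
      have h1 : Continuous fun x : S2 => fderiv ℝ Y x :=
        (hY.continuous_fderiv (by simp)).comp continuous_subtype_val
      unfold sphereDiv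
      refine (continuous_finsetSum _ fun i _ => ?_).sub
        ((h1.clm_apply continuous_subtype_val).inner continuous_subtype_val)
      exact (EuclideanSpace.proj (𝕜 := ℝ) i : E3 →L[ℝ] ℝ).continuous.comp
        (h1.clm_apply continuous_const)
    simp_rw [hpt]
    rw [integral_sub (integrable_sphere (hdc hUXs)) (integrable_sphere
      (by exact (hU.continuous.comp continuous_subtype_val).mul (hdc hX))), h0, zero_sub]


/-! ### Zonal functions and Archimedes' theorem -/

theorem inner_sphere_mem_Icc (p x : S2) : inner ℝ (p : E3) (x : E3) ∈ Icc (-1 : ℝ) 1 := by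
  have h := abs_real_inner_le_norm (p : E3) (x : E3)
  rw [norm_eq_of_mem_sphere, norm_eq_of_mem_sphere, one_mul] at h
  exact abs_le.1 h

/-- The integrated form of the divergence theorem for zonal fields. -/
theorem integral_zonal {g : ℝ → ℝ} (hg : ContDiff ℝ ∞ g) (p : S2) :
    ∫ x : S2, (deriv g (inner ℝ (p : E3) (x : E3)) * (1 - inner ℝ (p : E3) (x : E3) ^ 2)
      - 2 * inner ℝ (p : E3) (x : E3) * g (inner ℝ (p : E3) (x : E3))) ∂area = 0 := by
  let ℓ : E3 →L[ℝ] ℝ := innerSL ℝ (p : E3)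
  have hℓ : ∀ y, ℓ y = inner ℝ (p : E3) y := fun y => rfl
  -- On the sphere `V` is the gradient of the height `t = ⟨p, x⟩`: its divergence is `-2t`, and the
  -- derivative of `t` along it is `1 - t²`.
  let V : E3 → E3 := fun y => (p : E3) - ℓ y • y
  have hV : ContDiff ℝ ∞ V := contDiff_const.sub (ℓ.contDiff.smul contDiff_id)
  have hVT : IsTangentAlongSphere V := fun x => by
    simp [V, hℓ, inner_sub_left, inner_smul_left]
  have hU : ContDiff ℝ ∞ fun y => g (ℓ y) := hg.comp ℓ.contDiff
  have hUV : ContDiff ℝ ∞ fun y => g (ℓ y) • V y := hU.smul hV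
  have h0 := integral_sphereDiv hUV fun x => by rw [inner_smul_left, hVT x, mul_zero]
  rw [← h0]
  refine integral_congr_ae (ae_of_all _ fun x => ?_)
  have hVd : fderiv ℝ V x = -(ℓ x • ContinuousLinearMap.id ℝ E3 + ℓ.smulRight (x : E3)) := by
    have := ((ℓ.hasFDerivAt (x := (x : E3))).smul (hasFDerivAt_id (𝕜 := ℝ) (x : E3))).const_sub
      (p : E3)
    exact this.fderiv
  have hUd : fderiv ℝ (fun y => g (ℓ y)) x = deriv g (ℓ x) • ℓ := by
    have hd := (hg.differentiable (by simp) (ℓ x)).hasDerivAt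
    exact (hd.comp_hasFDerivAt (x : E3) ℓ.hasFDerivAt).fderiv
  have hdiv : sphereDiv V x = -2 * ℓ x := by
    have hx := inner_self_sphere x
    have e : ∀ v, fderiv ℝ V x v = -(ℓ x • v + ℓ v • (x : E3)) := fun v => by rw [hVd]; rfl
    have hs : ℓ x = ℓ (EuclideanSpace.single (0 : Fin 3) (1 : ℝ)) * (x : E3) 0 +
        ℓ (EuclideanSpace.single (1 : Fin 3) (1 : ℝ)) * (x : E3) 1 +
        ℓ (EuclideanSpace.single (2 : Fin 3) (1 : ℝ)) * (x : E3) 2 := by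
      conv_lhs => rw [eq_sum_single (x : E3)]
      simp only [map_add, map_smul, smul_eq_mul]
      ring
    unfold sphereDiv
    simp only [e, inner_neg_left, inner_add_left, inner_smul_left, hx, Fin.sum_univ_three]
    simp
    linarith
  beta_reduce
  rw [sphereDiv_smul hU hV hVT, hUd, hdiv]
  have : ℓ (V x) = 1 - ℓ x ^ 2 := by
    simp only [V, map_sub, map_smul, smul_eq_mul]
    rw [hℓ (p : E3), inner_self_sphere]
    ring
  rw [smul_apply, this, smul_eq_mul, hℓ]
  ring

/-- The zonal identity for `t ^ (n + 1)` gives `(n + 1) mₙ = (n + 3) mₙ₊₂` for the moments; the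
integrals of `t ^ n` over `[-1, 1]` obey the same recursion. -/
theorem integral_inner_pow (p : S2) (n : ℕ) :
    ∫ x : S2, inner ℝ (p : E3) (x : E3) ^ n ∂area =
      area.real univ / 2 * ∫ t in (-1 : ℝ)..1, t ^ n := by
  have hi : ∀ n : ℕ, Integrable (fun x : S2 => inner ℝ (p : E3) (x : E3) ^ n) area := fun n =>
    integrable_sphere ((continuous_const.inner continuous_subtype_val).pow n)
  induction n using Nat.twoStepInduction with
  | zero =>
    simp only [pow_zero, integral_const, smul_eq_mul, mul_one, intervalIntegral.integral_const]
    ring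
  | one =>
    have h := integral_zonal (g := fun _ => 1) contDiff_const p
    simp only [deriv_const, zero_mul, mul_one, zero_sub, integral_neg, integral_const_mul] at h
    simp only [pow_one, integral_id]
    linarith
  | more n ih _ =>
    have h := integral_zonal (g := fun t => t ^ (n + 1)) (contDiff_id.pow _) p
    have e : ∀ x : S2, deriv (fun t : ℝ => t ^ (n + 1)) (inner ℝ (p : E3) (x : E3)) *
        (1 - inner ℝ (p : E3) (x : E3) ^ 2) - 2 * inner ℝ (p : E3) (x : E3) *
        inner ℝ (p : E3) (x : E3) ^ (n + 1) = (n + 1) * inner ℝ (p : E3) (x : E3) ^ n -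
        (n + 3) * inner ℝ (p : E3) (x : E3) ^ (n + 2) := by
      intro x
      simp
      ring
    simp_rw [e] at h
    rw [integral_sub ((hi n).const_mul _) ((hi (n + 2)).const_mul _), integral_const_mul,
      integral_const_mul, ih] at h
    rw [integral_pow] at h ⊢
    have h3 : (n : ℝ) + 3 ≠ 0 := by positivity
    have h1 : (n : ℝ) + 1 ≠ 0 := by positivity
    apply mul_left_cancel₀ h3
    push_cast
    rw [show (n : ℝ) + 2 + 1 = n + 3 by ring]
    field_simp at h ⊢
    simp only [pow_succ] at h ⊢
    linarith

theorem integral_inner_polynomial (p : S2) (q : Polynomial ℝ) :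
    ∫ x : S2, q.eval (inner ℝ (p : E3) (x : E3)) ∂area =
      area.real univ / 2 * ∫ t in (-1 : ℝ)..1, q.eval t := by
  induction q using Polynomial.induction_on' with
  | add f g hf hg =>
    have hi : ∀ f : Polynomial ℝ,
        Integrable (fun x : S2 => f.eval (inner ℝ (p : E3) (x : E3))) area :=
      fun f => integrable_sphere (f.continuous.comp (continuous_const.inner continuous_subtype_val))
    simp only [Polynomial.eval_add]
    rw [integral_add (hi f) (hi g), intervalIntegral.integral_add
      (f.continuous.intervalIntegrable _ _) (g.continuous.intervalIntegrable _ _), hf, hg]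
    ring
  | monomial n a =>
    simp only [Polynomial.eval_monomial, integral_const_mul, intervalIntegral.integral_const_mul,
      integral_inner_pow]
    ring

theorem continuous_comp_inner {f : ℝ → ℝ} (hf : ContinuousOn f (Icc (-1) 1)) (p : S2) :
    Continuous fun x : S2 => f (inner ℝ (p : E3) (x : E3)) :=
  hf.comp_continuous (continuous_const.inner continuous_subtype_val)
    fun x => inner_sphere_mem_Icc p x

/-- Archimedes' theorem: the height over a plane is uniformly distributed on the sphere. -/
theorem integral_comp_inner {f : ℝ → ℝ} (hf : ContinuousOn f (Icc (-1) 1)) (p : S2) :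
    ∫ x : S2, f (inner ℝ (p : E3) (x : E3)) ∂area =
      area.real univ / 2 * ∫ t in (-1 : ℝ)..1, f t := by
  set A := area.real univ with hA
  have hA0 : 0 ≤ A := measureReal_nonneg
  refine eq_of_abs_sub_le_all fun η hη => ?_
  -- Weierstrass approximation. Each side moves by at most `A` times the tolerance, together `η A /
  -- (A + 1) ≤ η`.
  obtain ⟨q, hq⟩ := exists_polynomial_near_of_continuousOn (-1) 1 f hf (η / (2 * (A + 1)))
    (by positivity)
  have h1 : ‖∫ x : S2, (f (inner ℝ (p : E3) (x : E3)) - q.eval (inner ℝ (p : E3) (x : E3))) ∂area‖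
      ≤ η / (2 * (A + 1)) * A := by
    refine norm_integral_le_of_norm_le_const (ae_of_all _ fun x => ?_)
    rw [Real.norm_eq_abs, abs_sub_comm]
    exact (hq _ (inner_sphere_mem_Icc p x)).le
  have h2 : ‖∫ t in (-1 : ℝ)..1, (f t - q.eval t)‖ ≤ η / (2 * (A + 1)) * |1 - (-1)| := by
    refine intervalIntegral.norm_integral_le_of_norm_le_const fun t ht => ?_
    rw [uIoc_of_le (by norm_num)] at ht
    rw [Real.norm_eq_abs, abs_sub_comm]
    exact (hq _ ⟨ht.1.le, ht.2⟩).le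
  rw [integral_sub (integrable_sphere (continuous_comp_inner hf p))
    (integrable_sphere (continuous_comp_inner q.continuous.continuousOn p)),
    integral_inner_polynomial] at h1
  rw [intervalIntegral.integral_sub (hf.intervalIntegrable_of_Icc (by norm_num))
    (q.continuous.intervalIntegrable _ _)] at h2
  rw [Real.norm_eq_abs] at h1 h2
  norm_num at h2
  set F := ∫ t in (-1 : ℝ)..1, f t
  set Q := ∫ t in (-1 : ℝ)..1, q.eval t
  have h3 : |A / 2 * Q - A / 2 * F| ≤ A / 2 * (η / (2 * (A + 1)) * 2) := by
    rw [← mul_sub, abs_mul, abs_of_nonneg (by positivity : 0 ≤ A / 2), abs_sub_comm]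
    gcongr
  refine (abs_sub_le _ _ _).trans ((add_le_add h1 h3).trans ?_)
  have : η / (2 * (A + 1)) * A + A / 2 * (η / (2 * (A + 1)) * 2) = η * (A / (A + 1)) := by
    field_simp
    ring
  rw [this]
  exact mul_le_of_le_one_right hη.le ((div_le_one (by positivity)).2 (by linarith))

theorem area_real_univ_pos : 0 < area.real univ := by
  have : area ≠ 0 := Measure.toSphere_ne_zero _
  have h : area univ ≠ 0 := fun h => this (Measure.measure_univ_eq_zero.1 h)
  exact ENNReal.toReal_pos h (measure_ne_top _ _)

instance : NeZero area := ⟨Measure.toSphere_ne_zero _⟩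

theorem average_eq_div (f : S2 → ℝ) : ⨍ x, f x ∂area = (∫ x, f x ∂area) / area.real univ := by
  rw [average_eq, smul_eq_mul, inv_mul_eq_div]

theorem average_comp_inner {f : ℝ → ℝ} (hf : ContinuousOn f (Icc (-1) 1)) (p : S2) :
    ⨍ x : S2, f (inner ℝ (p : E3) (x : E3)) ∂area = (∫ t in (-1 : ℝ)..1, f t) / 2 := by
  rw [average_eq_div, integral_comp_inner hf]
  have := area_real_univ_pos.ne'
  field_simp

theorem average_mono {f g : S2 → ℝ} (hf : Continuous f) (hg : Continuous g) (h : ∀ x, f x ≤ g x) :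
    ⨍ x, f x ∂area ≤ ⨍ x, g x ∂area := by
  rw [average_eq_div, average_eq_div]
  exact div_le_div_of_nonneg_right
    (integral_mono (integrable_sphere hf) (integrable_sphere hg) h) measureReal_nonneg

/-! ### Averages of powers of the regularized distance -/

/-- The regularized squared distance to the point `p`. -/
def regDist (ε : ℝ) (p x : E3) : ℝ := ε + ‖x - p‖ ^ 2

theorem regDist_pos {ε : ℝ} (hε : 0 < ε) (p x : E3) : 0 < regDist ε p x := by
  unfold regDist; positivity

theorem contDiff_regDist (ε : ℝ) (p : E3) : ContDiff ℝ ∞ (regDist ε p) :=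
  contDiff_const.add ((contDiff_id.sub contDiff_const).norm_sq ℝ)

theorem regDist_sphere (ε : ℝ) (p x : S2) :
    regDist ε p x = ε + 2 - 2 * inner ℝ (p : E3) (x : E3) := by
  rw [regDist, norm_sub_sq_real, norm_eq_of_mem_sphere, norm_eq_of_mem_sphere, real_inner_comm]
  ring

/-- On the sphere `|x - p|² = 2 - 2t` is affine in the height `t`, hence uniform on `[0, 4]` by
Archimedes. -/
theorem average_comp_regDist {φ F : ℝ → ℝ} {ε : ℝ} (p : S2)
    (hφ : ContinuousOn φ (Icc ε (ε + 4))) (hF : ∀ y ∈ Icc ε (ε + 4), HasDerivAt F (φ y) y) :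
    ⨍ x : S2, φ (regDist ε p x) ∂area = (F (ε + 4) - F ε) / 4 := by
  have hm : ∀ t ∈ Icc (-1 : ℝ) 1, ε + 2 - 2 * t ∈ Icc ε (ε + 4) := fun t ht =>
    ⟨by linarith [ht.2], by linarith [ht.1]⟩
  simp_rw [regDist_sphere]
  have hc : ContinuousOn (fun t => φ (ε + 2 - 2 * t)) (Icc (-1) 1) :=
    hφ.comp (by fun_prop) hm
  rw [average_comp_inner hc p]
  have := intervalIntegral.integral_eq_sub_of_hasDerivAt (a := -1) (b := 1)
    (f := fun t => -F (ε + 2 - 2 * t) / 2) (f' := fun t => φ (ε + 2 - 2 * t)) (fun t ht => ?_)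
    (hc.intervalIntegrable_of_Icc (by norm_num))
  · rw [this]
    rw [show ε + 2 - 2 * 1 = ε by ring, show ε + 2 - 2 * (-1) = ε + 4 by ring]
    ring
  · rw [uIcc_of_le (by norm_num)] at ht
    have h1 : HasDerivAt (fun t : ℝ => ε + 2 - 2 * t) (-2) t := by
      simpa using ((hasDerivAt_id t).const_mul 2).const_sub (ε + 2)
    have := (((hF _ (hm t ht)).comp t h1).neg).div_const 2
    convert! this using 1
    ring

theorem average_regDist_inv_sq {ε : ℝ} (hε : 0 < ε) (p : S2) :
    ⨍ x : S2, (regDist ε p x ^ 2)⁻¹ ∂area = 1 / (ε * (ε + 4)) := by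
  have hne : ∀ y ∈ Icc ε (ε + 4), y ≠ 0 := fun y hy => (hε.trans_le hy.1).ne'
  rw [average_comp_regDist (φ := fun y => (y ^ 2)⁻¹) (F := fun y => -y⁻¹) p]
  · field_simp
    ring
  · exact (continuousOn_id.pow 2).inv₀ fun y hy => pow_ne_zero _ (hne y hy)
  · intro y hy
    convert! (hasDerivAt_inv (hne y hy)).neg using 1
    simp

theorem average_regDist_inv {ε : ℝ} (hε : 0 < ε) (p : S2) :
    ⨍ x : S2, (regDist ε p x)⁻¹ ∂area = (Real.log (ε + 4) - Real.log ε) / 4 := by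
  have hne : ∀ y ∈ Icc ε (ε + 4), y ≠ 0 := fun y hy => (hε.trans_le hy.1).ne'
  rw [average_comp_regDist (φ := fun y => y⁻¹) (F := Real.log) p]
  · exact continuousOn_id.inv₀ hne
  · exact fun y hy => Real.hasDerivAt_log (hne y hy)

/-- Controls all remainders: this bound is uniform in `ε`, whereas the exponents `-2` (mass of
`e^{2u}`) and `-1` (energy) give orders `1/ε` and `-log ε`. -/
theorem average_regDist_inv_sqrt_le {ε : ℝ} (hε : 0 < ε) (hε1 : ε ≤ 1) (p : S2) :
    ⨍ x : S2, (√(regDist ε p x))⁻¹ ∂area ≤ 3 / 2 := by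
  have hpos : ∀ y ∈ Icc ε (ε + 4), 0 < y := fun y hy => hε.trans_le hy.1
  rw [average_comp_regDist (φ := fun y => (√y)⁻¹) (F := fun y => 2 * √y) p]
  · have h1 : √(ε + 4) ≤ 3 := by
      rw [Real.sqrt_le_left (by norm_num)]
      linarith
    have h2 := Real.sqrt_nonneg ε
    linarith
  · exact (Real.continuous_sqrt.continuousOn).inv₀ fun y hy => (Real.sqrt_pos.2 (hpos y hy)).ne'
  · intro y hy
    have h := (Real.hasDerivAt_sqrt (hpos y hy).ne').const_mul 2
    have := (Real.sqrt_pos.2 (hpos y hy)).ne'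
    convert! h using 1
    field_simp

/-! ### Asymptotics of bubble sums -/

section Bubbles


theorem memH1_of_contDiff {U : E3 → ℝ} (hU : ContDiff ℝ ∞ U) : MemH1 fun x => U x :=
  ⟨memLp_sphere (hU.continuous.comp continuous_subtype_val) 2, _,
    isWeakGradient_tangGrad hU⟩

theorem average_norm_weakGrad_sq {U : E3 → ℝ} (hU : ContDiff ℝ ∞ U) :
    ⨍ x, ‖weakGrad (fun x => U x) x‖ ^ 2 ∂area = ⨍ x, ‖tangGrad U x‖ ^ 2 ∂area := by
  refine average_congr ?_
  filter_upwards [(weakGrad_spec (memH1_of_contDiff hU)).ae_eq (isWeakGradient_tangGrad hU)]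
    with x hx
  rw [hx]

theorem continuous_tangGrad {U : E3 → ℝ} (hU : ContDiff ℝ ∞ U) : Continuous (tangGrad U) := by
  have hg : Continuous fun x : S2 => gradient U x :=
    (continuous_gradient hU).comp continuous_subtype_val
  unfold tangGrad
  fun_prop

variable {ι : Type*} [Fintype ι]

/-- A sum of logarithmic bubbles at the points `p i`. -/
def bubbleSum (p : ι → S2) (ε : ℝ) (x : E3) : ℝ := -∑ i, Real.log (regDist ε (p i) x)

theorem contDiff_bubbleSum (p : ι → S2) {ε : ℝ} (hε : 0 < ε) : ContDiff ℝ ∞ (bubbleSum p ε) :=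
  (ContDiff.sum fun i _ => (contDiff_regDist ε (p i)).log fun x =>
    (regDist_pos hε (p i) x).ne').neg

theorem continuous_regDist_sphere (ε : ℝ) (p : S2) : Continuous fun x : S2 => regDist ε p x :=
  (contDiff_regDist ε p).continuous.comp continuous_subtype_val

theorem regDist_le_five {ε : ℝ} (hε1 : ε ≤ 1) (p x : S2) : regDist ε p x ≤ 5 := by
  rw [regDist_sphere]
  linarith [(inner_sphere_mem_Icc p x).1]

theorem exp_two_mul_bubbleSum (p : ι → S2) {ε : ℝ} (hε : 0 < ε) (x : E3) :
    Real.exp (2 * bubbleSum p ε x) = ∏ i, (regDist ε (p i) x ^ 2)⁻¹ := by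
  rw [bubbleSum, mul_neg, Finset.mul_sum, ← Finset.sum_neg_distrib, Real.exp_sum]
  refine Finset.prod_congr rfl fun i _ => ?_
  rw [Real.exp_neg, mul_comm, Real.exp_mul, Real.exp_log (regDist_pos hε _ _)]
  norm_num

theorem continuous_exp_bubbleSum (p : ι → S2) {ε : ℝ} (hε : 0 < ε) :
    Continuous fun x => Real.exp (2 * bubbleSum p ε x) :=
  Real.continuous_exp.comp (continuous_const.mul (contDiff_bubbleSum p hε).continuous)

/-- One bubble is kept; every other factor is at least `1/25`, because `regDist ≤ 5`. The last `5`
bounds `ε + 4`. -/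
theorem le_average_exp_bubbleSum [Nonempty ι] (p : ι → S2) {ε : ℝ} (hε : 0 < ε) (hε1 : ε ≤ 1) :
    (25 : ℝ)⁻¹ ^ Fintype.card ι / 5 / ε ≤
      ⨍ x : S2, Real.exp (2 * bubbleSum p ε x) ∂area := by
  classical
  obtain ⟨i₀⟩ := ‹Nonempty ι›
  have hpos : ∀ i (x : S2), 0 < regDist ε (p i) x := fun i x => regDist_pos hε _ _
  have h1 : ⨍ x : S2, (25 : ℝ)⁻¹ ^ Fintype.card ι * (regDist ε (p i₀) x ^ 2)⁻¹ ∂area ≤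
      ⨍ x : S2, Real.exp (2 * bubbleSum p ε x) ∂area := by
    refine average_mono (continuous_const.mul
      (((continuous_regDist_sphere ε (p i₀)).pow 2).inv₀ fun x => (pow_pos (hpos i₀ x) 2).ne'))
      ((continuous_exp_bubbleSum p hε).comp continuous_subtype_val) fun x => ?_
    rw [exp_two_mul_bubbleSum p hε, ← Finset.mul_prod_erase _ _ (Finset.mem_univ i₀), mul_comm]
    have h2 : (25 : ℝ)⁻¹ ^ (Finset.univ.erase i₀).card ≤
        ∏ i ∈ Finset.univ.erase i₀, (regDist ε (p i) x ^ 2)⁻¹ := by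
      rw [← Finset.prod_const]
      refine Finset.prod_le_prod (fun _ _ => by norm_num) fun i _ => ?_
      have := regDist_le_five hε1 (p i) x
      have h0 := hpos i x
      gcongr
      nlinarith
    have h3 : (25 : ℝ)⁻¹ ^ Fintype.card ι ≤ (25 : ℝ)⁻¹ ^ (Finset.univ.erase i₀).card :=
      pow_le_pow_of_le_one (by norm_num) (by norm_num) (Finset.card_le_univ _)
    have := hpos i₀ x
    gcongr
    exact h3.trans h2
  refine le_trans ?_ h1
  rw [average_eq_div, integral_const_mul, mul_div_assoc, ← average_eq_div,
    average_regDist_inv_sq hε, div_div, div_eq_mul_one_div]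
  exact mul_le_mul_of_nonneg_left (one_div_le_one_div_of_le (by positivity) (by nlinarith))
    (by positivity)

theorem continuous_inv_sqrt_regDist {ε : ℝ} (hε : 0 < ε) (p : S2) :
    Continuous fun x : S2 => (√(regDist ε p x))⁻¹ :=
  (Real.continuous_sqrt.comp (continuous_regDist_sphere ε p)).inv₀ fun x =>
    (Real.sqrt_pos.2 (regDist_pos hε p x)).ne'

theorem average_finset_sum {f : ι → S2 → ℝ} (hf : ∀ i, Continuous (f i)) :
    ⨍ x, ∑ i, f i x ∂area = ∑ i, ⨍ x, f i x ∂area := by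
  simp_rw [average_eq_div]
  rw [integral_finsetSum _ fun i _ => integrable_sphere (hf i), Finset.sum_div]

theorem average_const_mul (a : ℝ) (f : S2 → ℝ) : ⨍ x, a * f x ∂area = a * ⨍ x, f x ∂area := by
  rw [average_eq_div, integral_const_mul, mul_div_assoc, ← average_eq_div]

/-- Uses `-log y ≤ 2 / √y`, which is `log z ≤ z - 1` at `z = 1 / √y`. -/
theorem average_bubbleSum_le (p : ι → S2) {ε : ℝ} (hε : 0 < ε) (hε1 : ε ≤ 1) :
    ⨍ x : S2, bubbleSum p ε x ∂area ≤ 3 * Fintype.card ι := by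
  have h1 : ⨍ x : S2, bubbleSum p ε x ∂area ≤
      ⨍ x : S2, ∑ i, 2 * (√(regDist ε (p i) x))⁻¹ ∂area := by
    refine average_mono ((contDiff_bubbleSum p hε).continuous.comp continuous_subtype_val)
      (continuous_finsetSum _ fun i _ => continuous_const.mul
        (continuous_inv_sqrt_regDist hε (p i))) fun x => ?_
    rw [bubbleSum, ← Finset.sum_neg_distrib]
    refine Finset.sum_le_sum fun i _ => ?_
    have hy := regDist_pos hε (p i : E3) (x : E3)
    have h := Real.log_le_sub_one_of_pos (inv_pos.2 (Real.sqrt_pos.2 hy))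
    rw [Real.log_inv, Real.log_sqrt hy.le] at h
    linarith
  refine h1.trans ?_
  rw [average_finset_sum (f := fun i x => 2 * (√(regDist ε (p i) x))⁻¹)
    fun i => continuous_const.mul (continuous_inv_sqrt_regDist hε (p i))]
  simp_rw [average_const_mul]
  calc _ ≤ ∑ _i : ι, (3 : ℝ) := Finset.sum_le_sum fun i _ => by
        linarith [average_regDist_inv_sqrt_le hε hε1 (p i)]
    _ = _ := by simp [mul_comm]

theorem gradient_bubbleSum (p : ι → S2) {ε : ℝ} (hε : 0 < ε) (x : E3) :
    gradient (bubbleSum p ε) x = ∑ i, (2 * (regDist ε (p i) x)⁻¹) • ((p i : E3) - x) := by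
  have h1 : ∀ i, HasFDerivAt (fun y => Real.log (regDist ε (p i) y))
      ((regDist ε (p i) x)⁻¹ • (2 • innerSL ℝ (x - p i))) x := by
    intro i
    have h2 : HasFDerivAt (fun y : E3 => y - p i) (ContinuousLinearMap.id ℝ E3) x :=
      (hasFDerivAt_id x).sub_const _
    have h3 : HasFDerivAt (regDist ε (p i)) (2 • innerSL ℝ (x - p i)) x := by
      have := h2.norm_sq.const_add ε
      rwa [ContinuousLinearMap.comp_id] at this
    exact h3.log (regDist_pos hε _ _).ne'
  have h4 : fderiv ℝ (bubbleSum p ε) x =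
      -∑ i, (regDist ε (p i) x)⁻¹ • (2 • innerSL ℝ (x - p i)) :=
    (HasFDerivAt.fun_sum fun i _ => h1 i).neg.fderiv
  refine ext_inner_right ℝ fun v => ?_
  rw [gradient, InnerProductSpace.toDual_symm_apply, h4, sum_inner]
  simp only [neg_apply, sum_apply, smul_apply, innerSL_apply_apply,
    ← Finset.sum_neg_distrib]
  refine Finset.sum_congr rfl fun i _ => ?_
  rw [inner_smul_left, ← neg_sub x, inner_neg_left]
  simp
  ring

/-- The tangential part of `p` at `x` has squared norm `1 - t² ≤ 2 - 2t ≤ y`, so a bubble has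
gradient at most `(2 / y) √y`. -/
theorem norm_tangGrad_bubbleSum_le (p : ι → S2) {ε : ℝ} (hε : 0 < ε) (x : S2) :
    ‖tangGrad (bubbleSum p ε) x‖ ≤ ∑ i, 2 * (√(regDist ε (p i) x))⁻¹ := by
  have h : tangGrad (bubbleSum p ε) x = ∑ i, (2 * (regDist ε (p i) x)⁻¹) •
      ((p i : E3) - inner ℝ (p i : E3) (x : E3) • (x : E3)) := by
    rw [tangGrad, gradient_bubbleSum p hε, sum_inner, Finset.sum_smul, ← Finset.sum_sub_distrib]
    refine Finset.sum_congr rfl fun i _ => ?_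
    rw [inner_smul_left, inner_sub_left, inner_self_sphere]
    simp only [smul_sub, smul_smul, mul_sub, sub_smul, RCLike.conj_to_real]
    simp
  rw [h]
  refine (norm_sum_le _ _).trans (Finset.sum_le_sum fun i _ => ?_)
  set y := regDist ε (p i : E3) (x : E3) with hy
  set t := inner ℝ (p i : E3) (x : E3) with ht
  have hy0 : 0 < y := regDist_pos hε _ _
  have hn : ‖(p i : E3) - t • (x : E3)‖ ≤ √y := by
    refine Real.le_sqrt_of_sq_le ?_
    rw [← real_inner_self_eq_norm_sq, inner_sub_left, inner_sub_right, inner_sub_right,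
      inner_smul_left, inner_smul_right, inner_smul_left, inner_smul_right, inner_self_sphere,
      inner_self_sphere, real_inner_comm (p i : E3) (x : E3), ← ht, hy, regDist_sphere, ← ht]
    simp only [RCLike.conj_to_real]
    nlinarith [sq_nonneg (1 - t)]
  rw [norm_smul, Real.norm_of_nonneg (by positivity), mul_assoc]
  gcongr
  calc y⁻¹ * ‖(p i : E3) - t • (x : E3)‖ ≤ y⁻¹ * √y := by gcongr
    _ = (√y)⁻¹ := by
      have := Real.sqrt_pos.2 hy0
      nth_rewrite 1 [← Real.mul_self_sqrt hy0.le]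
      field_simp

theorem exists_separation [Nonempty ι] {p : ι → S2} (hp : Function.Injective p) :
    ∃ d > 0, ∀ i j, i ≠ j → 2 * d ≤ ‖(p i : E3) - p j‖ := by
  classical
  -- The value `1` on the diagonal keeps the minimum over all pairs positive, also when there is
  -- only one point.
  let f : ι × ι → ℝ := fun q => if q.1 = q.2 then 1 else ‖(p q.1 : E3) - p q.2‖ / 2
  obtain ⟨q, hq⟩ := Finite.exists_min f
  refine ⟨f q, ?_, fun i j hij => ?_⟩
  · by_cases h : q.1 = q.2
    · simp [f, h]
    · have : (p q.1 : E3) - p q.2 ≠ 0 := fun h0 => h (hp (Subtype.ext (sub_eq_zero.1 h0)))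
      have := norm_pos_iff.2 this
      simp only [f, h, if_false]
      positivity
  · have := hq (i, j)
    simp only [f, hij, if_false] at this ⊢
    linarith

/-- At most one `a i` exceeds `M`, so each cross term is at most `M (a i + a j)`: beyond the squares
only linear terms remain. -/
theorem sum_sq_le_of_pairwise {a : ι → ℝ} (ha : ∀ i, 0 ≤ a i) {M : ℝ}
    (hM : ∀ i j, i ≠ j → a i ≤ M ∨ a j ≤ M) (hM0 : 0 ≤ M) :
    (∑ i, a i) ^ 2 ≤ ∑ i, a i ^ 2 + 2 * Fintype.card ι * M * ∑ i, a i := by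
  classical
  rw [sq, Finset.sum_mul_sum]
  calc ∑ i, ∑ j, a i * a j ≤ ∑ i, ∑ j, ((if i = j then a i ^ 2 else 0) + M * (a i + a j)) := by
        refine Finset.sum_le_sum fun i _ => Finset.sum_le_sum fun j _ => ?_
        have hi := ha i
        have hj := ha j
        by_cases h : i = j
        · subst h
          rw [if_pos rfl]
          nlinarith [mul_nonneg hM0 hi]
        · rw [if_neg h, zero_add]
          rcases hM i j h with h | h
          · nlinarith [mul_le_mul_of_nonneg_right h hj, mul_nonneg hM0 hi]
          · nlinarith [mul_le_mul_of_nonneg_left h hi, mul_nonneg hM0 hj]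
    _ = _ := by
        simp only [Finset.sum_add_distrib, Finset.sum_ite_eq, Finset.mem_univ, if_true,
          ← Finset.mul_sum, Finset.sum_const, Finset.card_univ, nsmul_eq_mul]
        ring

/-- The squares `4 / y` average to `log (ε + 4) - log ε` each, whence the sharp coefficient `k`. A
point lies within `d` of at most one `p i`, so the cross terms are linear in `1 / √y` and bounded on
average. -/
theorem average_tangGrad_bubbleSum_le [Nonempty ι] {p : ι → S2} (hp : Function.Injective p) :
    ∃ C, ∀ ε : ℝ, 0 < ε → ε ≤ 1 → ⨍ x, ‖tangGrad (bubbleSum p ε) x‖ ^ 2 ∂area ≤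
      Fintype.card ι * -Real.log ε + C := by
  obtain ⟨d, hd, hsep⟩ := exists_separation hp
  set k := (Fintype.card ι : ℝ) with hk
  refine ⟨k * Real.log 5 + 2 * k * (2 * d⁻¹) * (3 * k), fun ε hε hε1 => ?_⟩
  have hs : ∀ i (x : S2), 0 < √(regDist ε (p i) x) := fun i x =>
    Real.sqrt_pos.2 (regDist_pos hε _ _)
  have hc1 : ∀ i, Continuous fun x : S2 => 4 * (regDist ε (p i) x)⁻¹ := fun i =>
    continuous_const.mul ((continuous_regDist_sphere ε (p i)).inv₀ fun x =>
      (regDist_pos hε (p i : E3) x).ne')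
  have hc2 : ∀ i, Continuous fun x : S2 => 2 * (√(regDist ε (p i) x))⁻¹ := fun i =>
    continuous_const.mul (continuous_inv_sqrt_regDist hε (p i))
  have hC1 := continuous_finsetSum Finset.univ fun i _ => hc1 i
  have hC2 := continuous_finsetSum Finset.univ fun i _ => hc2 i
  have h1 : ⨍ x, ‖tangGrad (bubbleSum p ε) x‖ ^ 2 ∂area ≤
      ⨍ x : S2, (∑ i, 4 * (regDist ε (p i) x)⁻¹ +
        2 * k * (2 * d⁻¹) * ∑ i, 2 * (√(regDist ε (p i) x))⁻¹) ∂area := by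
    refine average_mono ((continuous_tangGrad (contDiff_bubbleSum p hε)).norm.pow 2)
      (hC1.add (continuous_const.mul hC2)) fun x => ?_
    calc _ ≤ (∑ i, 2 * (√(regDist ε (p i) x))⁻¹) ^ 2 := by
          gcongr
          exact norm_tangGrad_bubbleSum_le p hε x
      _ ≤ ∑ i, (2 * (√(regDist ε (p i) x))⁻¹) ^ 2 +
          2 * k * (2 * d⁻¹) * ∑ i, 2 * (√(regDist ε (p i) x))⁻¹ := by
          refine sum_sq_le_of_pairwise (fun i => (mul_pos two_pos (inv_pos.2 (hs i x))).le)
            (fun i j hij => ?_) (by positivity)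
          have key : ∀ i, d ≤ ‖(x : E3) - p i‖ → 2 * (√(regDist ε (p i) x))⁻¹ ≤ 2 * d⁻¹ := by
            intro i hi
            gcongr
            refine Real.le_sqrt_of_sq_le ?_
            unfold regDist
            nlinarith
          by_contra! hcon
          have hi : ‖(x : E3) - p i‖ < d := lt_of_not_ge fun h => (key i h).not_gt hcon.1
          have hj : ‖(x : E3) - p j‖ < d := lt_of_not_ge fun h => (key j h).not_gt hcon.2
          have h2 := hsep i j hij
          have h3 := norm_sub_le_norm_sub_add_norm_sub (p i : E3) x (p j)
          rw [norm_sub_rev (p i : E3) x] at h3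
          linarith
      _ = _ := by
          congr 1
          refine Finset.sum_congr rfl fun i _ => ?_
          rw [mul_pow, inv_pow, Real.sq_sqrt (regDist_pos hε _ _).le]
          norm_num
  refine h1.trans ?_
  rw [average_eq_div, integral_add (integrable_sphere hC1)
    ((integrable_sphere hC2).const_mul _), add_div, ← average_eq_div, ← average_eq_div,
    average_const_mul, average_finset_sum hc1, average_finset_sum hc2]
  have h5 : ∑ i, ⨍ x : S2, 4 * (regDist ε (p i) x)⁻¹ ∂area ≤ k * (Real.log 5 - Real.log ε) := by
    rw [hk, ← nsmul_eq_mul, ← Finset.card_univ, ← Finset.sum_const]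
    refine Finset.sum_le_sum fun i _ => ?_
    rw [average_const_mul, average_regDist_inv hε]
    have := Real.log_le_log (by linarith : 0 < ε + 4) (by linarith : ε + 4 ≤ 5)
    linarith
  have h6 : ∑ i, ⨍ x : S2, 2 * (√(regDist ε (p i) x))⁻¹ ∂area ≤ 3 * k := by
    rw [mul_comm, hk, ← nsmul_eq_mul, ← Finset.card_univ, ← Finset.sum_const]
    refine Finset.sum_le_sum fun i _ => ?_
    rw [average_const_mul]
    linarith [average_regDist_inv_sqrt_le hε hε1 (p i)]
  have h7 : 2 * k * (2 * d⁻¹) * ∑ i, ⨍ x : S2, 2 * (√(regDist ε (p i) x))⁻¹ ∂area ≤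
      2 * k * (2 * d⁻¹) * (3 * k) := by gcongr
  linarith

/-- If the inequality holds for the bubbles concentrating at `k` points, then `1 / k ≤ α`. -/
theorem one_div_card_le [Nonempty ι] {p : ι → S2} (hp : Function.Injective p) {α c : ℝ}
    (hα : 0 < α) (H : ∀ᶠ ε in 𝓝[>] (0 : ℝ), MTOInequality α c fun x => bubbleSum p ε x) :
    1 / (Fintype.card ι : ℝ) ≤ α := by
  obtain ⟨C, hC⟩ := average_tangGrad_bubbleSum_le hp
  have hk0 : (0 : ℝ) < Fintype.card ι := by exact_mod_cast Fintype.card_pos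
  set k := (Fintype.card ι : ℝ) with hk
  by_contra! hcon
  rw [lt_div_iff₀ hk0] at hcon
  -- All bounded terms of the inequality. If `α k < 1`, then `(1 - α k) (-log ε)` eventually exceeds
  -- them.
  set D := α * C + 2 * (3 * k) + c - Real.log ((25 : ℝ)⁻¹ ^ Fintype.card ι / 5) with hD
  have hlog : Tendsto (fun ε => (1 - α * k) * -Real.log ε) (𝓝[>] (0 : ℝ)) atTop :=
    Tendsto.const_mul_atTop (by linarith) (tendsto_neg_atBot_atTop.comp Real.tendsto_log_nhdsGT_zero)
  have h1 : ∀ᶠ ε in 𝓝[>] (0 : ℝ), ε ≤ 1 :=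
    eventually_nhdsWithin_of_eventually_nhds (Iic_mem_nhds one_pos)
  obtain ⟨ε, hm, hbig, hε1, hε⟩ :=
    (H.and ((hlog.eventually_gt_atTop D).and (h1.and self_mem_nhdsWithin))).exists
  have hε : 0 < ε := hε
  unfold MTOInequality at hm
  rw [average_norm_weakGrad_sq (contDiff_bubbleSum p hε)] at hm
  have hB := average_bubbleSum_le p hε hε1
  have hE := mul_le_mul_of_nonneg_left (hC ε hε hε1) hα.le
  have hL := Real.log_le_log (by positivity) (le_average_exp_bubbleSum p hε hε1)
  rw [Real.log_div (by positivity) hε.ne'] at hL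
  linarith

end Bubbles


/-! ### Symmetries and moments of bubble sums -/

section Symmetry

variable {ι : Type*} [Fintype ι]

theorem bubbleSum_isometry {p : ι → S2} {L : E3 ≃ₗᵢ[ℝ] E3} {σ : Equiv.Perm ι}
    (h : ∀ i, L (p i) = p (σ i)) (ε : ℝ) (x : E3) : bubbleSum p ε (L x) = bubbleSum p ε x := by
  unfold bubbleSum
  rw [← Equiv.sum_comp σ]
  congr 1
  refine Finset.sum_congr rfl fun i _ => ?_
  rw [regDist, regDist, ← h, ← map_sub, L.norm_map]

theorem integral_mul_exp_isometry {p : ι → S2} {L : E3 ≃ₗᵢ[ℝ] E3} {σ : Equiv.Perm ι}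
    (h : ∀ i, L (p i) = p (σ i)) {ε : ℝ} (hε : 0 < ε) {f : E3 → ℝ} (hf : Continuous f) :
    ∫ x : S2, f (L x) * Real.exp (2 * bubbleSum p ε x) ∂area =
      ∫ x : S2, f x * Real.exp (2 * bubbleSum p ε x) ∂area := by
  rw [← integral_comp_isometry L (f := fun x => f x * Real.exp (2 * bubbleSum p ε x))
    (hf.mul (continuous_exp_bubbleSum p hε))]
  simp_rw [bubbleSum_isometry h]

theorem continuous_coord (i : Fin 3) : Continuous fun x : E3 => x i :=
  (EuclideanSpace.proj (𝕜 := ℝ) i : E3 →L[ℝ] ℝ).continuous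

/-- The second moments of `e^{2u}`. -/
def secondMoment (u : E3 → ℝ) (i j : Fin 3) : ℝ :=
  ∫ x : S2, (x : E3) i * (x : E3) j * Real.exp (2 * u x) ∂area

theorem secondMoment_comm (u : E3 → ℝ) (i j : Fin 3) : secondMoment u i j = secondMoment u j i := by
  simp_rw [secondMoment, mul_comm ((_ : E3) i)]

theorem integrable_mul_exp {f u : E3 → ℝ} (hf : Continuous f) (hu : Continuous u) :
    Integrable (fun x : S2 => f x * Real.exp (2 * u x)) area :=
  integrable_sphere (f := fun x : S2 => f x * Real.exp (2 * u x))
    ((hf.mul (Real.continuous_exp.comp (continuous_const.mul hu))).comp continuous_subtype_val)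

theorem trace_secondMoment {u : E3 → ℝ} (hu : Continuous u) :
    secondMoment u 0 0 + secondMoment u 1 1 + secondMoment u 2 2 =
      ∫ x : S2, Real.exp (2 * u x) ∂area := by
  have hi : ∀ i, Integrable (fun x : S2 => (x : E3) i * (x : E3) i * Real.exp (2 * u x)) area :=
    fun i => integrable_mul_exp ((continuous_coord i).mul (continuous_coord i)) hu
  unfold secondMoment
  rw [← integral_add (hi 0) (hi 1), ← integral_add (by exact (hi 0).add (hi 1)) (hi 2)]
  refine integral_congr_ae (ae_of_all _ fun x => ?_)
  have := sum_sq_eq_one x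
  beta_reduce
  linear_combination Real.exp (2 * u x) * this

theorem integral_sq_sum_mul_exp {u : E3 → ℝ} (hu : Continuous u) :
    ∫ x : S2, ((x : E3) 0 + (x : E3) 1 + (x : E3) 2) ^ 2 * Real.exp (2 * u x) ∂area =
      ∑ i, ∑ j, secondMoment u i j := by
  have hi : ∀ i j, Integrable (fun x : S2 => (x : E3) i * (x : E3) j * Real.exp (2 * u x)) area :=
    fun i j => integrable_mul_exp (f := fun x => x i * x j)
      ((continuous_coord i).mul (continuous_coord j)) hu
  unfold secondMoment
  simp_rw [← integral_finsetSum Finset.univ fun j _ => hi _ j]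
  rw [← integral_finsetSum _ fun i _ => integrable_finsetSum _ fun j _ => hi i j]
  refine integral_congr_ae (ae_of_all _ fun x => ?_)
  simp only [Fin.sum_univ_three]
  ring

theorem integral_exp_sphere_pos {u : E3 → ℝ} (hu : Continuous u) :
    0 < ∫ x : S2, Real.exp (2 * u x) ∂area :=
  integral_exp_pos (integrable_sphere
    ((Real.continuous_exp.comp (continuous_const.mul hu)).comp continuous_subtype_val))

theorem Lam_eq {u : E3 → ℝ} (hu : Continuous u) (i j : Fin 3) :
    Lam (fun x => u x) i j = (secondMoment u i j - 1 / 3 * (if i = j then 1 else 0) *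
      ∫ x : S2, Real.exp (2 * u x) ∂area) / ∫ x : S2, Real.exp (2 * u x) ∂area := by
  unfold Lam secondMoment
  rw [← integral_const_mul, ← integral_sub (integrable_mul_exp (f := fun x => x i * x j)
    ((continuous_coord i).mul (continuous_coord j)) hu)
    (integrable_mul_exp (f := fun _ => 1 / 3 * (if i = j then 1 else 0)) continuous_const hu)]
  congr 2
  ext x
  ring

theorem frobNorm_sq (A : Matrix (Fin 3) (Fin 3) ℝ) : frobNorm A ^ 2 = ∑ i, ∑ j, A i j ^ 2 :=
  Real.sq_sqrt (Finset.sum_nonneg fun _ _ => Finset.sum_nonneg fun _ _ => sq_nonneg _)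

theorem bubbleSum_mem_zeroMoment {p : ι → S2} {ε : ℝ} (hε : 0 < ε)
    (h : ∀ i : Fin 3, ∫ x : S2, (x : E3) i * Real.exp (2 * bubbleSum p ε x) ∂area = 0) :
    (fun x : S2 => bubbleSum p ε x) ∈ zeroMoment :=
  ⟨memH1_of_contDiff (contDiff_bubbleSum p hε), h⟩

end Symmetry

/-! ### Coordinate isometries and integer directions -/

/-- The isometry permuting the coordinates. -/
def permIso (e : Equiv.Perm (Fin 3)) : E3 ≃ₗᵢ[ℝ] E3 := LinearIsometryEquiv.piLpCongrLeft 2 ℝ ℝ e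

theorem permIso_apply (e : Equiv.Perm (Fin 3)) (x : E3) (i : Fin 3) :
    permIso e x i = x (e.symm i) := rfl

/-- The rotation by `π` around the `k`-th coordinate axis. -/
def halfTurn (k : Fin 3) : E3 ≃ₗᵢ[ℝ] E3 :=
  LinearIsometryEquiv.piLpCongrRight 2 fun i =>
    if i = k then LinearIsometryEquiv.refl ℝ ℝ else LinearIsometryEquiv.neg ℝ

theorem halfTurn_apply (k : Fin 3) (x : E3) (i : Fin 3) :
    halfTurn k x i = if i = k then x i else -x i := by
  unfold halfTurn
  rw [LinearIsometryEquiv.piLpCongrRight_apply]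
  by_cases h : i = k <;> simp [h]

theorem secondMoment_perm {ι : Type*} [Fintype ι] {p : ι → S2} {e : Equiv.Perm (Fin 3)}
    {σ : Equiv.Perm ι} (h : ∀ i, permIso e (p i) = p (σ i)) {ε : ℝ} (hε : 0 < ε) (i j : Fin 3) :
    secondMoment (bubbleSum p ε) (e.symm i) (e.symm j) = secondMoment (bubbleSum p ε) i j :=
  integral_mul_exp_isometry h hε (f := fun x => x i * x j)
    ((continuous_coord i).mul (continuous_coord j))

/-- The point of the sphere in the direction of an integer vector `s` of squared length `N`. -/
def intDir (N : ℕ) [NeZero N] (s : Fin 3 → ℤ) (hs : ∑ j, s j ^ 2 = N) : S2 :=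
  ⟨(√(N : ℝ))⁻¹ • WithLp.toLp 2 fun j => (s j : ℝ), by
    have h : ‖(WithLp.toLp 2 fun j => (s j : ℝ) : E3)‖ = √(N : ℝ) := by
      rw [EuclideanSpace.norm_eq]
      congr 1
      simp only [Real.norm_eq_abs, sq_abs]
      exact_mod_cast hs
    have hN : 0 < √(N : ℝ) := Real.sqrt_pos.2 (Nat.cast_pos.2 (NeZero.pos N))
    rw [mem_sphere_zero_iff_norm, norm_smul, h, norm_inv, Real.norm_of_nonneg hN.le,
      inv_mul_cancel₀ hN.ne']⟩

theorem intDir_apply (N : ℕ) [NeZero N] (s : Fin 3 → ℤ) (hs : ∑ j, s j ^ 2 = N) (j : Fin 3) :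
    (intDir N s hs : E3) j = (√(N : ℝ))⁻¹ * s j := rfl

theorem intDir_injective {ι : Type*} {N : ℕ} [NeZero N] {s : ι → Fin 3 → ℤ}
    (hs : ∀ i, ∑ j, s i j ^ 2 = N) (hinj : Function.Injective s) :
    Function.Injective fun i => intDir N (s i) (hs i) := by
  intro i i' h
  refine hinj (funext fun j => ?_)
  have h1 : (√(N : ℝ))⁻¹ * s i j = (√(N : ℝ))⁻¹ * s i' j :=
    congrFun (congrArg (fun x : S2 => (x : E3).ofLp) h) j
  have hN : 0 < √(N : ℝ) := Real.sqrt_pos.2 (Nat.cast_pos.2 (NeZero.pos N))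
  exact_mod_cast mul_left_cancel₀ (inv_pos.2 hN).ne' h1

theorem permIso_intDir {N : ℕ} [NeZero N] {s t : Fin 3 → ℤ} (hs : ∑ j, s j ^ 2 = N)
    (ht : ∑ j, t j ^ 2 = N) {e : Equiv.Perm (Fin 3)} (h : ∀ j, s (e.symm j) = t j) :
    permIso e (intDir N s hs) = intDir N t ht := by
  ext j
  rw [permIso_apply, intDir_apply, intDir_apply, h]

theorem halfTurn_intDir {N : ℕ} [NeZero N] {s t : Fin 3 → ℤ} (hs : ∑ j, s j ^ 2 = N)
    (ht : ∑ j, t j ^ 2 = N) {k : Fin 3} (h : ∀ j, (if j = k then s j else -s j) = t j) :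
    halfTurn k (intDir N s hs) = intDir N t ht := by
  ext j
  rw [halfTurn_apply, intDir_apply, intDir_apply, ← h]
  split_ifs <;> simp

/-! ### The regular tetrahedron -/

/-- The directions of the vertices of a regular tetrahedron. -/
def tetraVec (i : Fin 4) (j : Fin 3) : ℤ := if i = 0 ∨ i = j.succ then 1 else -1

/-- The vertices of a regular tetrahedron. -/
def tetra (i : Fin 4) : S2 := intDir 3 (tetraVec i) (by revert i; decide)

theorem tetra_injective : Function.Injective tetra :=
  intDir_injective (s := tetraVec) _ (by decide)

theorem halfTurn_zero_tetra (i : Fin 4) :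
    halfTurn 0 (tetra i) = tetra ((Equiv.swap 0 1 * Equiv.swap 2 3 : Equiv.Perm (Fin 4)) i) :=
  halfTurn_intDir _ _ (by revert i; decide)

theorem halfTurn_one_tetra (i : Fin 4) :
    halfTurn 1 (tetra i) = tetra ((Equiv.swap 0 2 * Equiv.swap 1 3 : Equiv.Perm (Fin 4)) i) :=
  halfTurn_intDir _ _ (by revert i; decide)

theorem permIso_swap_zero_one_tetra (i : Fin 4) :
    permIso (Equiv.swap 0 1) (tetra i) = tetra (Equiv.swap 1 2 i) :=
  permIso_intDir _ _ (by revert i; decide)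

theorem permIso_swap_one_two_tetra (i : Fin 4) :
    permIso (Equiv.swap 1 2) (tetra i) = tetra (Equiv.swap 2 3 i) :=
  permIso_intDir _ _ (by revert i; decide)

/-- Every coordinate changes sign under one of the two half turns. -/
theorem tetra_mem_zeroMoment {ε : ℝ} (hε : 0 < ε) :
    (fun x : S2 => bubbleSum tetra ε x) ∈ zeroMoment := by
  refine bubbleSum_mem_zeroMoment hε fun i => ?_
  have h0 := integral_mul_exp_isometry halfTurn_zero_tetra hε (continuous_coord i)
  have h1 := integral_mul_exp_isometry halfTurn_one_tetra hε (continuous_coord i)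
  simp only [halfTurn_apply] at h0 h1
  by_cases hi : i = 0
  · have : i ≠ 1 := by rw [hi]; decide
    simp only [this, if_false, neg_mul, integral_neg] at h1
    linarith
  · simp only [hi, if_false, neg_mul, integral_neg] at h0
    linarith

/-- Half turns kill the off-diagonal second moments, coordinate swaps equate the diagonal ones, and
the trace makes each a third of the mass. -/
theorem Lam_tetra {ε : ℝ} (hε : 0 < ε) : Lam (fun x => bubbleSum tetra ε x) = 0 := by
  have hu := (contDiff_bubbleSum tetra hε).continuous
  have hd01 := secondMoment_perm permIso_swap_zero_one_tetra hε 0 0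
  have hd12 := secondMoment_perm permIso_swap_one_two_tetra hε 1 1
  simp only [Equiv.symm_swap, Equiv.swap_apply_left] at hd01 hd12
  have htr := trace_secondMoment hu
  have h0 : ∀ i : Fin 3, i ≠ 0 → secondMoment (bubbleSum tetra ε) 0 i = 0 := by
    intro i hi
    have h := integral_mul_exp_isometry halfTurn_zero_tetra hε (f := fun x => x 0 * x i)
      ((continuous_coord 0).mul (continuous_coord i))
    simp only [halfTurn_apply, hi, if_false, if_true, mul_neg, neg_mul, integral_neg] at h
    unfold secondMoment
    linarith
  have h12 : secondMoment (bubbleSum tetra ε) 1 2 = 0 := by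
    have h := integral_mul_exp_isometry halfTurn_one_tetra hε (f := fun x => x 1 * x 2)
      ((continuous_coord 1).mul (continuous_coord 2))
    have : (2 : Fin 3) ≠ 1 := by decide
    simp only [halfTurn_apply, this, if_false, if_true, mul_neg, neg_mul, integral_neg] at h
    unfold secondMoment
    linarith
  ext i j
  rw [Lam_eq hu, Matrix.zero_apply, div_eq_zero_iff]
  left
  rcases eq_or_ne i j with rfl | hij
  · rw [if_pos rfl]
    fin_cases i <;> simp only [Fin.zero_eta, Fin.mk_one, Fin.reduceFinMk] <;> linarith
  · rw [if_neg hij, mul_zero, zero_mul, sub_zero]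
    have h01 := h0 1 (by decide)
    have h02 := h0 2 (by decide)
    fin_cases i <;> fin_cases j <;>
      simp_all [secondMoment_comm _ 1 0, secondMoment_comm _ 2 0, secondMoment_comm _ 2 1]

theorem one_fourth_le {α δ c : ℝ} (hα : 0 < α) (hδ : δ ≤ 1 / 6)
    (H : ∀ u ∈ zeroMoment, frobNorm (Lam u) ^ 2 ≤ 1 / 6 - δ → MTOInequality α c u) :
    1 / 4 ≤ α := by
  have h := one_div_card_le tetra_injective hα (c := c) ?_
  · simpa using h
  · filter_upwards [self_mem_nhdsWithin] with ε hε
    refine H _ (tetra_mem_zeroMoment hε) ?_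
    rw [Lam_tetra hε, frobNorm_sq]
    simp
    linarith

/-! ### The equilateral triangle -/

/-- The directions of the vertices of an equilateral triangle. -/
def triVec (i j : Fin 3) : ℤ := if i = j then 2 else -1

/-- The vertices of an equilateral triangle on a great circle. -/
def tri (i : Fin 3) : S2 := intDir 6 (triVec i) (by revert i; decide)

theorem tri_injective : Function.Injective tri :=
  intDir_injective (s := triVec) _ (by decide)

theorem permIso_tri (e : Equiv.Perm (Fin 3)) (i : Fin 3) : permIso e (tri i) = tri (e i) :=
  permIso_intDir _ _ fun j => by
    unfold triVec
    simp only [Equiv.eq_symm_apply]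

/-- The reflection in the plane orthogonal to `(1, 1, 1)`. -/
def diagReflection : E3 ≃ₗᵢ[ℝ] E3 :=
  Submodule.reflection (ℝ ∙ (WithLp.toLp 2 fun _ => 1 : E3))ᗮ

theorem diagReflection_apply (x : E3) (i : Fin 3) :
    diagReflection x i = x i - 2 / 3 * (x 0 + x 1 + x 2) := by
  unfold diagReflection
  rw [Submodule.reflection_orthogonal_apply, Submodule.reflection_singleton_apply]
  have h : ‖(WithLp.toLp 2 fun _ => 1 : E3)‖ ^ 2 = 3 := by
    rw [EuclideanSpace.norm_sq_eq]
    simp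
  rw [inner_eq_sum]
  simp [h]
  ring

theorem diagReflection_tri (i : Fin 3) : diagReflection (tri i) = tri (Equiv.refl _ i) := by
  have h : triVec i 0 + triVec i 1 + triVec i 2 = 0 := by revert i; decide
  ext j
  rw [diagReflection_apply]
  simp only [tri, intDir_apply, ← mul_add, Equiv.refl_apply]
  rw_mod_cast [h]
  simp

/-- Permutations make the three first moments equal; the reflection reverses the sign of their sum.
-/
theorem tri_mem_zeroMoment {ε : ℝ} (hε : 0 < ε) :
    (fun x : S2 => bubbleSum tri ε x) ∈ zeroMoment := by
  have hu := (contDiff_bubbleSum tri hε).continuous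
  have hi : ∀ i : Fin 3, Integrable (fun x : S2 => (x : E3) i *
      Real.exp (2 * bubbleSum tri ε x)) area := fun i => integrable_mul_exp (continuous_coord i) hu
  have hp : ∀ i, ∫ x : S2, (x : E3) i * Real.exp (2 * bubbleSum tri ε x) ∂area =
      ∫ x : S2, (x : E3) 0 * Real.exp (2 * bubbleSum tri ε x) ∂area := by
    intro i
    rw [← integral_mul_exp_isometry (permIso_tri (Equiv.swap 0 i)) hε (continuous_coord i)]
    simp only [permIso_apply, Equiv.symm_swap, Equiv.swap_apply_right]
  have hr := integral_mul_exp_isometry diagReflection_tri hε (f := fun x => x 0 + x 1 + x 2)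
    (((continuous_coord 0).add (continuous_coord 1)).add (continuous_coord 2))
  have e : ∀ x : S2, (diagReflection x 0 + diagReflection x 1 + diagReflection x 2) *
      Real.exp (2 * bubbleSum tri ε x) = -(((x : E3) 0 + (x : E3) 1 + (x : E3) 2) *
      Real.exp (2 * bubbleSum tri ε x)) := fun x => by
    simp only [diagReflection_apply]
    ring
  simp_rw [e, integral_neg, add_mul] at hr
  rw [integral_add (by exact (hi 0).add (hi 1)) (hi 2), integral_add (hi 0) (hi 1), hp 1,
    hp 2] at hr
  refine bubbleSum_mem_zeroMoment hε fun i => ?_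
  rw [hp i]
  linarith

/-- Permutations act transitively on indices and on ordered pairs of distinct indices, so only one
off-diagonal moment stays unknown. -/
theorem secondMoment_tri {ε : ℝ} (hε : 0 < ε) (i j : Fin 3) :
    secondMoment (bubbleSum tri ε) i j =
    if i = j then (∫ x : S2, Real.exp (2 * bubbleSum tri ε x) ∂area) / 3
    else secondMoment (bubbleSum tri ε) 0 1 := by
  have hp := fun e => secondMoment_perm (permIso_tri e) hε
  split_ifs with hij
  · subst hij
    have hd : ∀ k, secondMoment (bubbleSum tri ε) k k = secondMoment (bubbleSum tri ε) i i := by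
      intro k
      rw [← hp (Equiv.swap k i) i i, Equiv.symm_swap, Equiv.swap_apply_right]
    have htr := trace_secondMoment (contDiff_bubbleSum tri hε).continuous
    rw [hd 0, hd 1, hd 2] at htr
    linarith
  · obtain ⟨e, h0, h1⟩ : ∃ e : Equiv.Perm (Fin 3), e.symm i = 0 ∧ e.symm j = 1 := by
      revert i j
      decide
    rw [← hp e i j, h0, h1]

theorem frobNorm_Lam_tri_sq {ε : ℝ} (hε : 0 < ε) :
    frobNorm (Lam fun x => bubbleSum tri ε x) ^ 2 =
      6 * (secondMoment (bubbleSum tri ε) 0 1 /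
        ∫ x : S2, Real.exp (2 * bubbleSum tri ε x) ∂area) ^ 2 := by
  rw [frobNorm_sq]
  simp only [Lam_eq (contDiff_bubbleSum tri hε).continuous, Fin.sum_univ_three]
  simp only [secondMoment_tri hε 0 0, secondMoment_tri hε 1 1, secondMoment_tri hε 2 2,
    secondMoment_tri hε 0 2, secondMoment_tri hε 1 0, secondMoment_tri hε 1 2,
    secondMoment_tri hε 2 0, secondMoment_tri hε 2 1]
  norm_num [Fin.ext_iff]
  ring

/-- Near the triangle the second moment in the direction `(1, 1, 1)` is small. -/
theorem sq_sum_mul_exp_tri_le {ε : ℝ} (hε : 0 < ε) (x : S2) :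
    ((x : E3) 0 + (x : E3) 1 + (x : E3) 2) ^ 2 * Real.exp (2 * bubbleSum tri ε x) ≤
      Real.exp (2 * bubbleSum tri ε x) + 3 * 9 ^ 3 := by
  set s := (x : E3) 0 + (x : E3) 1 + (x : E3) 2 with hs
  have hx := sum_sq_eq_one x
  have hs3 : s ^ 2 ≤ 3 := by
    nlinarith [sq_nonneg ((x : E3) 0 - (x : E3) 1), sq_nonneg ((x : E3) 1 - (x : E3) 2),
      sq_nonneg ((x : E3) 0 - (x : E3) 2)]
  have hw := Real.exp_pos (2 * bubbleSum tri ε x)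
  -- For `s² ≤ 1` the bound is immediate. Otherwise `x` has squared distance at least `s² / 3 > 1/3`
  -- from the plane of the triangle, so each of the three factors is at most `9`, while `s² ≤ 3`.
  rcases le_or_gt (s ^ 2) 1 with h1 | h1
  · nlinarith
  have hy : ∀ i, 3⁻¹ ≤ regDist ε (tri i) x := by
    intro i
    have ht : triVec i 0 + triVec i 1 + triVec i 2 = 0 := by revert i; decide
    have ht' : (tri i : E3) 0 + (tri i : E3) 1 + (tri i : E3) 2 = 0 := by
      simp only [tri, intDir_apply, ← mul_add]
      rw_mod_cast [ht]
      simp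
    rw [regDist, EuclideanSpace.norm_sq_eq, Fin.sum_univ_three]
    simp only [PiLp.sub_apply, Real.norm_eq_abs, sq_abs]
    set a := (x : E3) 0 - (tri i : E3) 0
    set b := (x : E3) 1 - (tri i : E3) 1
    set c := (x : E3) 2 - (tri i : E3) 2
    have habc : s = a + b + c := by simp only [a, b, c]; linarith
    rw [habc] at h1
    nlinarith [sq_nonneg (a - b), sq_nonneg (b - c), sq_nonneg (a - c)]
  have hw9 : Real.exp (2 * bubbleSum tri ε x) ≤ 9 ^ 3 := by
    rw [exp_two_mul_bubbleSum tri hε]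
    calc _ ≤ ∏ _i : Fin 3, (9 : ℝ) := by
          refine Finset.prod_le_prod (fun i _ => by positivity) fun i _ => ?_
          have := hy i
          rw [inv_le_comm₀ (pow_pos (by linarith) 2) (by norm_num)]
          nlinarith
      _ = 9 ^ 3 := by simp
  nlinarith

/-- The moment `W + 6 b` in direction `(1, 1, 1)` lies between `0` and `2 W` once the mass `W`
absorbs the error `3 * 9 ^ 3`. Hence `|b / W| ≤ 1/6`, and `6 / 36 = 1/6`. -/
theorem frobNorm_Lam_tri_sq_le {ε : ℝ} (hε : 0 < ε)
    (hbig : 3 * 9 ^ 3 ≤ ⨍ x : S2, Real.exp (2 * bubbleSum tri ε x) ∂area) :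
    frobNorm (Lam fun x => bubbleSum tri ε x) ^ 2 ≤ 1 / 6 := by
  have hu := (contDiff_bubbleSum tri hε).continuous
  have hW := integral_exp_sphere_pos hu
  have hwi : Integrable (fun x : S2 => Real.exp (2 * bubbleSum tri ε x)) area :=
    integrable_sphere ((continuous_exp_bubbleSum tri hε).comp continuous_subtype_val)
  rw [frobNorm_Lam_tri_sq hε]
  rw [average_eq_div, le_div_iff₀ area_real_univ_pos] at hbig
  set W := ∫ x : S2, Real.exp (2 * bubbleSum tri ε x) ∂area with hWdef
  set b := secondMoment (bubbleSum tri ε) 0 1 with hb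
  have hsum : Continuous fun x : E3 => (x 0 + x 1 + x 2) ^ 2 :=
    (((continuous_coord 0).add (continuous_coord 1)).add (continuous_coord 2)).pow 2
  have hN : ∫ x : S2, ((x : E3) 0 + (x : E3) 1 + (x : E3) 2) ^ 2 *
      Real.exp (2 * bubbleSum tri ε x) ∂area = W + 6 * b := by
    rw [integral_sq_sum_mul_exp hu]
    simp only [Fin.sum_univ_three]
    simp only [secondMoment_tri hε 0 0, secondMoment_tri hε 1 1, secondMoment_tri hε 2 2,
      secondMoment_tri hε 0 2, secondMoment_tri hε 1 0, secondMoment_tri hε 1 2,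
      secondMoment_tri hε 2 0, secondMoment_tri hε 2 1]
    norm_num [Fin.ext_iff]
    ring
  have hN0 : 0 ≤ W + 6 * b := by
    rw [← hN]
    exact integral_nonneg fun x => by positivity
  have hN1 : W + 6 * b ≤ 2 * W := by
    rw [← hN]
    refine (integral_mono (integrable_mul_exp hsum hu) (by exact hwi.add (integrable_const _))
      (sq_sum_mul_exp_tri_le hε)).trans ?_
    rw [integral_add hwi (integrable_const _), integral_const, smul_eq_mul]
    linarith
  have h1 : (b / W) ^ 2 ≤ (1 / 6) ^ 2 := by
    refine sq_le_sq' ?_ ?_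
    · rw [le_div_iff₀ hW]
      linarith
    · rw [div_le_iff₀ hW]
      linarith
  linarith

/-- `δ < 1/2` means `1/6 < 2/3 - δ`; the blow-up of the mass as `ε → 0` supplies the hypothesis of
the `1/6` bound. -/
theorem one_third_le {α δ c : ℝ} (hα : 0 < α) (hδ : δ < 1 / 2)
    (H : ∀ u ∈ zeroMoment, frobNorm (Lam u) ^ 2 ≤ 2 / 3 - δ → MTOInequality α c u) :
    1 / 3 ≤ α := by
  have h := one_div_card_le tri_injective hα (c := c) ?_
  · simpa using h
  · have hlim : Tendsto (fun ε : ℝ => (25 : ℝ)⁻¹ ^ Fintype.card (Fin 3) / 5 / ε) (𝓝[>] 0) atTop :=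
      tendsto_inv_nhdsGT_zero.const_mul_atTop (by positivity)
    have h1 : ∀ᶠ ε in 𝓝[>] (0 : ℝ), ε ≤ 1 :=
      eventually_nhdsWithin_of_eventually_nhds (Iic_mem_nhds one_pos)
    filter_upwards [self_mem_nhdsWithin, h1, hlim.eventually_ge_atTop (3 * 9 ^ 3)]
      with ε hε hε1 hbig
    refine H _ (tri_mem_zeroMoment hε) ?_
    linarith [frobNorm_Lam_tri_sq_le hε (hbig.trans (le_average_exp_bubbleSum tri hε hε1))]

end SphereMTO

end

theorem mainTheorem6 (α : ℝ) (hα : 0 < α) :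
    (∀ δ : ℝ, 0 < δ → δ < 1 / 2 → ∀ c : ℝ,
      (∀ u ∈ SphereMTO.zeroMoment,
        SphereMTO.frobNorm (SphereMTO.Lam u) ^ 2 ≤ 2 / 3 - δ → SphereMTO.MTOInequality α c u) →
      1 / 3 ≤ α) ∧
    (∀ δ : ℝ, 0 < δ → δ ≤ 1 / 6 → ∀ c : ℝ,
      (∀ u ∈ SphereMTO.zeroMoment,
        SphereMTO.frobNorm (SphereMTO.Lam u) ^ 2 ≤ 1 / 6 - δ → SphereMTO.MTOInequality α c u) →
      1 / 4 ≤ α) := by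
  exact ⟨fun _ _ hδ _ H => SphereMTO.one_third_le hα hδ H,
    fun _ _ hδ _ H => SphereMTO.one_fourth_le hα hδ H⟩
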